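/- Let $\varphi_e$ denote the $e$-th partial computable function $\mathbb N\rightharpoonup\mathbb N$ in a standard numbering. For an equivalence relation $E$ on $\mathbb N$ and $e\in\mathbb N$ put $$\mathrm{Cl}_E(e)=\{[\varphi_e(n)]_E : n\in\mathbb N,\ \varphi_e(n)\downarrow\},$$ and let the computable FS-jump $E^+$ be the equivalence relation on $\mathbb N$ given by $e\mathrel{E^+}e'\iff \mathrm{Cl}_E(e)=\mathrm{Cl}_E(e')$. For $A\subseteq\mathbb N$ let $E_A$ be the equivalence relation given by $m\mathrel{E_A}n\iff m=n$ or $m,n\in A$. A computable reduction from $E$ to $F$ is a total computable function $f:\mathbb N\to\mathbb N$ with $n\mathrel{E}n'\iff f(n)\mathrel{F}f(n')$ for all $n,n'$. A set $A\subseteq\mathbb N$ is maximal if it is c.e., $\mathbb N\setminus A$ is infinite, and for every c.e. set $W$ either $W\setminus A$ or $(\mathbb N\setminus W)\setminus A$ is finite. **Lemma.** Let $A$ be a maximal set. Then $E_A^+$ is self-full: if $f$ is a computable reduction from $E_A^+$ to $E_A^+$, then for every $y\in\mathbb N$ there is $x\in\mathbb N$ with $f(x)\mathrel{E_A^+}y$,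 i.e. the range of $f$ meets every $E_A^+$-class. Moreover, every such $f$ acts as a finite-support permutation of the $E_A$-classes: there is a permutation $\pi$ of $\mathbb N/E_A$ with $\pi(c)\neq c$ for only finitely many classes $c$, such that for all $e\in\mathbb N$ $$\mathrm{Cl}_{E_A}(f(e))=\{\pi(c): c\in \mathrm{Cl}_{E_A}(e)\}.$$ -/

import Mathlib

namespace CompFS

/-- The partial computable function `φ_e` of index `e`, in the standard numbering of programs. -/
def phi (e : ℕ) : ℕ →. ℕ :=
  (Denumerable.ofNat Nat.Partrec.Code e).eval

/-- The set of `E`-classes `{[φ_e(n)]_E : n ∈ ℕ, φ_e(n)↓}`. -/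
def enumClasses (E : Setoid ℕ) (e : ℕ) : Set (Quotient E) :=
  {c | ∃ n : ℕ, ∃ m ∈ phi e n, Quotient.mk E m = c}

/-- The computable FS-jump `E⁺`: two indices are related when they enumerate the same set of
`E`-classes. -/
def fsJump (E : Setoid ℕ) : Setoid ℕ where
  r e e' := enumClasses E e = enumClasses E e'
  iseqv := ⟨fun _ => rfl, fun h => h.symm, fun h h' => h.trans h'⟩

/-- The equivalence relation `E_A`: `m E_A n` iff `m = n` or both `m` and `n` are in `A`. -/
def setRel (A : Set ℕ) : Setoid ℕ where
  r m n := m = n ∨ (m ∈ A ∧ n ∈ A)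
  iseqv := by
    refine ⟨fun _ => Or.inl rfl, ?_, ?_⟩
    · rintro x y (h | ⟨h, h'⟩)
      · exact Or.inl h.symm
      · exact Or.inr ⟨h', h⟩
    · rintro x y z (rfl | ⟨h, h'⟩) (rfl | ⟨k, k'⟩)
      · exact Or.inl rfl
      · exact Or.inr ⟨k, k'⟩
      · exact Or.inr ⟨h, h'⟩
      · exact Or.inr ⟨h, k'⟩

/-- A set of natural numbers is computably enumerable. -/
def IsCE (W : Set ℕ) : Prop :=
  REPred fun n : ℕ => n ∈ W

/-- `A` is a maximal set: it is c.e. and coinfinite, and every c.e. set `W` either contains only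
finitely many or omits only finitely many elements of the complement of `A`. -/
def IsMaximalSet (A : Set ℕ) : Prop :=
  IsCE A ∧ Aᶜ.Infinite ∧ ∀ W : Set ℕ, IsCE W → (W \ A).Finite ∨ (Wᶜ \ A).Finite

/-- `f` is a computable reduction from `E` to `F`. -/
def IsReduction (f : ℕ → ℕ) (E F : Setoid ℕ) : Prop :=
  Computable f ∧ ∀ n n' : ℕ, E.r n n' ↔ F.r (f n) (f n')

/-- `E` is self-full: the range of every computable reduction of `E` to itself meets every
`E`-class. -/
def SelfFull (E : Setoid ℕ) : Prop :=
  ∀ f : ℕ → ℕ, IsReduction f E E → ∀ y : ℕ, ∃ x : ℕ, E.r (f x) y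

end CompFS

/-!
Write `B` for the complement of the maximal set `A` and `F` for the operator on c.e. sets of
`E_A`-classes induced by a reduction `f`. By the Rice–Shapiro argument (`riceShapiro_mono`,
`riceShapiro_compact`) `F` is monotone and is determined by its values on finite sets; it is
injective because `f` is a reduction.

Maximality enters through `IsMaximalSet.finite_ne_of_rePred`: a c.e. relation on `B` with finite
fibres is contained in the identity up to finitely many arguments. A selector that increases on `B`
has an orbit whose even and odd parts are disjoint infinite c.e. subsets of `B`; a decreasing one
splits `B` by the parity of the number of steps in a descent. It follows that a c.e. set of classes
is either finite, or cofinite with `A` among its members.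

Since `F` is injective and monotone, finite sets have finite images, and some finite `D` has the
class `A` both as a member and in its image. The relation `z ∈ F (D ∪ {y})` then lies in `B`: for
`z ∉ F D` the set of such `y` is a c.e. set of classes without `A`, hence finite. So
`c ∈ F (D ∪ {c})` for almost all `c`. Consequently the image of the complement of `{c}`
omits at most `c` and finitely many fixed classes, and by injectivity it does omit `c` for almost
all `c` (`IsMaximalSet.exists_jumpMap_subset_union`). Thus `F X ⊆ C ∪ X` for a fixed finite `C`, and
counting along chains of finite sets (`exists_perm_of_subset_union`) gives a permutation `π`,
supported on `C`, with `F X` the image of `X` under `π`. It fixes the class `A`, because otherwise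
`B` would be c.e.; hence preimages of c.e. sets of classes under `π` are c.e., which yields
self-fullness.
-/

/-! ### Computably enumerable predicates -/

section REPred

variable {α β : Type*} [Primcodable α] [Primcodable β]

/-- A c.e. predicate is the union of an increasing computable sequence of decidable stages. -/
theorem REPred.exists_stages {p : α → Prop} (hp : REPred p) :
    ∃ q : α → ℕ → Bool, Computable₂ q ∧ (∀ a, p a ↔ ∃ k, q a k = true) ∧
      ∀ a k l, k ≤ l → q a k = true → q a l = true := by
  obtain ⟨c, hc⟩ := Nat.Partrec.Code.exists_code.1 (Partrec.bind_decode₂_iff.1 hp)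
  refine ⟨fun a k => (Nat.Partrec.Code.evaln k c (Encodable.encode a)).isSome, ?_, ?_, ?_⟩
  · exact Primrec.option_isSome.to_comp.comp (Nat.Partrec.Code.primrec_evaln.to_comp.comp
      ((Computable.snd.pair (Computable.const c)).pair (Computable.encode.comp Computable.fst)))
  · intro a
    have h : p a ↔ (c.eval (Encodable.encode a)).Dom := by
      rw [hc]
      simp [Part.assert, Part.dom_iff_mem]
    rw [h, Part.dom_iff_mem]
    simp only [Nat.Partrec.Code.evaln_complete, Option.isSome_iff_exists, Option.mem_def]
    exact exists_comm
  · intro a k l hkl h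
    obtain ⟨x, hx⟩ := Option.isSome_iff_exists.1 h
    exact Option.isSome_iff_exists.2 ⟨x, Nat.Partrec.Code.evaln_mono hkl hx⟩

theorem REPred.of_stages {q : α → ℕ → Bool} (hq : Computable₂ q) :
    REPred fun a => ∃ k, q a k = true := by
  refine (Partrec.dom_re (Partrec.rfind (p := fun a k => Part.some (q a k)) hq.partrec₂)).of_eq ?_
  intro a
  rw [Part.dom_iff_mem]
  constructor
  · rintro ⟨n, h⟩
    exact ⟨n, (Part.mem_some_iff.1 (Nat.rfind_spec h)).symm⟩
  · rintro ⟨n, h⟩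
    obtain ⟨k, hk, -⟩ := Nat.rfind_min' (p := q a) h
    exact ⟨k, hk⟩

theorem REPred.comp {p : β → Prop} (hp : REPred p) {g : α → β} (hg : Computable g) :
    REPred fun a => p (g a) :=
  Partrec.comp hp hg

theorem REPred.or {p p' : α → Prop} (hp : REPred p) (hp' : REPred p') :
    REPred fun a => p a ∨ p' a := by
  obtain ⟨q, hq, h, -⟩ := hp.exists_stages
  obtain ⟨q', hq', h', -⟩ := hp'.exists_stages
  refine (REPred.of_stages (q := fun a k => q a k || q' a k)
    (Primrec.or.to_comp.comp hq hq')).of_eq fun a => ?_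
  simp [h, h', exists_or]

theorem REPred.and {p p' : α → Prop} (hp : REPred p) (hp' : REPred p') :
    REPred fun a => p a ∧ p' a := by
  obtain ⟨q, hq, h, hm⟩ := hp.exists_stages
  obtain ⟨q', hq', h', hm'⟩ := hp'.exists_stages
  refine (REPred.of_stages (q := fun a k => q a k && q' a k)
    (Primrec.and.to_comp.comp hq hq')).of_eq fun a => ?_
  simp only [h, h', Bool.and_eq_true]
  constructor
  · rintro ⟨k, hk, hk'⟩
    exact ⟨⟨k, hk⟩, ⟨k, hk'⟩⟩
  · rintro ⟨⟨k, hk⟩, ⟨l, hl⟩⟩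
    exact ⟨max k l, hm _ _ _ (le_max_left _ _) hk, hm' _ _ _ (le_max_right _ _) hl⟩

theorem REPred.exists_nat {p : α → ℕ → Prop} (hp : REPred fun x : α × ℕ => p x.1 x.2) :
    REPred fun a => ∃ n, p a n := by
  obtain ⟨q, hq, h, -⟩ := hp.exists_stages
  have hu : Computable fun x : α × ℕ => x.2.unpair := Computable.unpair.comp Computable.snd
  refine (REPred.of_stages (q := fun a k => q (a, k.unpair.1) k.unpair.2)
    (hq.comp (Computable.fst.pair (Computable.fst.comp hu)) (Computable.snd.comp hu))).of_eq
    fun a => ?_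
  constructor
  · rintro ⟨k, hk⟩
    exact ⟨k.unpair.1, (h (a, _)).2 ⟨_, hk⟩⟩
  · rintro ⟨n, hn⟩
    obtain ⟨k, hk⟩ := (h (a, n)).1 hn
    exact ⟨Nat.pair n k, by simpa using hk⟩

theorem REPred.of_computable {p : α → Bool} (hp : Computable p) : REPred fun a => p a = true :=
  (REPred.of_stages (q := fun a _ => p a) (hp.comp Computable.fst)).of_eq fun a => by simp

theorem REPred.nat_eq {g h : α → ℕ} (hg : Computable g) (hh : Computable h) :
    REPred fun a => g a = h a :=
  (REPred.of_computable (p := fun a => decide (g a = h a))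
    ((Primrec.eq (α := ℕ)).decide.to_comp.comp hg hh)).of_eq fun a => by simp

theorem REPred.nat_lt {g h : α → ℕ} (hg : Computable g) (hh : Computable h) :
    REPred fun a => g a < h a :=
  (REPred.of_computable (p := fun a => decide (g a < h a))
    (Primrec.nat_lt.decide.to_comp.comp hg hh)).of_eq fun a => by simp

theorem REPred.const (P : Prop) : REPred fun _ : α => P := by
  by_cases h : P
  · exact (REPred.of_computable (p := fun _ : α => true) (Computable.const _)).of_eq fun a => by
      simp [h]
  · exact (REPred.of_computable (p := fun _ : α => false) (Computable.const _)).of_eq fun a => by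
      simp [h]

/-- The graph of a partial recursive function is c.e. -/
theorem REPred.mem_partrec {g : α →. ℕ} (hg : Partrec g) : REPred fun x : α × ℕ => x.2 ∈ g x.1 := by
  have h1 : Partrec fun x : α × ℕ => (g x.1).bind fun m =>
      Nat.rfind fun _ => Part.some (decide (x.2 = m)) := by
    refine (hg.comp Computable.fst).bind (Partrec.rfind ?_)
    exact Computable.partrec ((Primrec.eq (α := ℕ)).decide.to_comp.comp
      (Computable.snd.comp (Computable.fst.comp Computable.fst))
      (Computable.snd.comp Computable.fst))
  refine (Partrec.dom_re h1).of_eq ?_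
  rintro ⟨a, n⟩
  rw [Part.dom_iff_mem]
  constructor
  · rintro ⟨k, hk⟩
    obtain ⟨m, hm, hk⟩ := Part.mem_bind_iff.1 hk
    have h : n = m := by simpa using Part.mem_some_iff.1 (Nat.rfind_spec hk)
    exact h ▸ hm
  · intro h
    obtain ⟨k, hk, -⟩ := Nat.rfind_min' (p := fun _ : ℕ => decide (n = n)) (m := 0) (by simp)
    exact ⟨k, Part.mem_bind_iff.2 ⟨n, h, hk⟩⟩

/-- A c.e. relation can be uniformized by a partial recursive function. -/
theorem REPred.exists_uniformization {p : α → ℕ → Prop} (hp : REPred fun x : α × ℕ => p x.1 x.2) :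
    ∃ g : α →. ℕ, Partrec g ∧ (∀ a, ∀ n ∈ g a, p a n) ∧ ∀ a, (∃ n, p a n) → ∃ n, n ∈ g a := by
  obtain ⟨q, hq, h, -⟩ := hp.exists_stages
  have hu : Computable fun x : α × ℕ => x.2.unpair := Computable.unpair.comp Computable.snd
  have hq' : Computable₂ fun (a : α) (k : ℕ) => q (a, k.unpair.1) k.unpair.2 :=
    hq.comp (Computable.fst.pair (Computable.fst.comp hu)) (Computable.snd.comp hu)
  refine ⟨fun a => (Nat.rfind fun k => Part.some (q (a, k.unpair.1) k.unpair.2)).map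
    fun k => k.unpair.1, ?_, ?_, ?_⟩
  · exact (Partrec.rfind hq'.partrec₂).map
      (Computable.fst.comp (Computable.unpair.comp Computable.snd))
  · intro a n hn
    obtain ⟨k, hk, rfl⟩ := (Part.mem_map_iff _).1 hn
    exact (h (a, _)).2 ⟨k.unpair.2, (Part.mem_some_iff.1 (Nat.rfind_spec hk)).symm⟩
  · rintro a ⟨n, hn⟩
    obtain ⟨k, hk⟩ := (h (a, n)).1 hn
    obtain ⟨m, hm, -⟩ := Nat.rfind_min' (p := fun k => q (a, k.unpair.1) k.unpair.2)
      (m := Nat.pair n k) (by simpa using hk)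
    exact ⟨_, Part.mem_map _ hm⟩

end REPred

namespace CompFS

/-! ### Indices of c.e. sets -/

/-- The c.e. set with index `e`, as the range of `φ_e`. -/
def rng (e : ℕ) : Set ℕ := {m | ∃ n, m ∈ phi e n}

theorem enumClasses_eq_image (E : Setoid ℕ) (e : ℕ) :
    enumClasses E e = Quotient.mk E '' rng e := by
  ext c
  constructor
  · rintro ⟨n, m, hm, rfl⟩
    exact ⟨m, ⟨n, hm⟩, rfl⟩
  · rintro ⟨m, ⟨n, hm⟩, rfl⟩
    exact ⟨n, m, hm, rfl⟩

theorem rePred_mem_rng : REPred fun x : ℕ × ℕ => x.2 ∈ rng x.1 := by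
  have h : Partrec fun x : (ℕ × ℕ) × ℕ => phi x.1.1 x.2 :=
    Nat.Partrec.Code.eval_part.comp
      ((Computable.ofNat Nat.Partrec.Code).comp (Computable.fst.comp Computable.fst))
      Computable.snd
  have h1 : REPred fun x : (ℕ × ℕ) × ℕ => x.1.2 ∈ phi x.1.1 x.2 :=
    (REPred.mem_partrec h).comp (g := fun x : (ℕ × ℕ) × ℕ => (x, x.1.2))
      (Computable.id.pair (Computable.snd.comp Computable.fst))
  exact h1.exists_nat

/-- A c.e. relation computably yields indices for its sections (the s-m-n theorem). -/
theorem exists_index_sections {R : ℕ → ℕ → Prop} (hR : REPred fun x : ℕ × ℕ => R x.1 x.2) :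
    ∃ i : ℕ → ℕ, Computable i ∧ ∀ x, rng (i x) = {n | R x n} := by
  have h0 : Partrec fun x : ℕ × ℕ =>
      (Part.assert (R x.1 x.2) fun _ => Part.some ()).map fun _ => x.2 :=
    Partrec.map hR (Computable.snd.comp Computable.fst)
  have h1 : Partrec fun n : ℕ =>
      (Part.assert (R n.unpair.1 n.unpair.2) fun _ => Part.some ()).map fun _ => n.unpair.2 :=
    h0.comp Computable.unpair
  obtain ⟨c, hc⟩ := Nat.Partrec.Code.exists_code.1 (Partrec.nat_iff.1 h1)
  refine ⟨fun x => Encodable.encode (c.curry x), ?_, ?_⟩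
  · exact Computable.encode.comp
      (Nat.Partrec.Code.primrec₂_curry.to_comp.comp (Computable.const c) Computable.id)
  · intro x
    ext m
    simp only [rng, phi, Denumerable.ofNat_encode, Nat.Partrec.Code.eval_curry, hc,
      Set.mem_ofPred_eq, Nat.unpair_pair, Part.mem_map_iff, Part.mem_assert_iff]
    constructor
    · rintro ⟨n, u, ⟨h, -⟩, rfl⟩
      exact h
    · intro h
      exact ⟨m, (), ⟨h, Part.mem_some _⟩, rfl⟩

theorem exists_index {W : Set ℕ} (hW : IsCE W) : ∃ e, rng e = W := by
  obtain ⟨i, -, hi⟩ := exists_index_sections (R := fun _ n => n ∈ W)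
    (REPred.comp hW Computable.snd)
  exact ⟨i 0, hi 0⟩

/-- A c.e. set may be enumerated by a program that knows its own index (Kleene's recursion
theorem). -/
theorem exists_index_self {R : ℕ → ℕ → Prop} (hR : REPred fun x : ℕ × ℕ => R x.1 x.2) :
    ∃ e, rng e = {n | R e n} := by
  obtain ⟨i, hi, h⟩ := exists_index_sections hR
  obtain ⟨c, hc⟩ := Nat.Partrec.Code.fixed_point
    (f := fun c => Denumerable.ofNat Nat.Partrec.Code (i (Encodable.encode c)))
    ((Computable.ofNat _).comp (hi.comp Computable.encode))
  refine ⟨Encodable.encode c, ?_⟩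
  rw [← h]
  simp only [rng, phi, Denumerable.ofNat_encode, hc]

/-! ### The operator on c.e. sets of classes induced by a reduction -/

section Operator

variable {E : Setoid ℕ}

/-- A set of `E`-classes is c.e. when the set of members of its classes is c.e. -/
def CEClasses (X : Set (Quotient E)) : Prop :=
  IsCE {n | Quotient.mk E n ∈ X}

theorem rePred_mem_enumClasses (hE : REPred fun x : ℕ × ℕ => E.r x.1 x.2) :
    REPred fun x : ℕ × ℕ => Quotient.mk E x.1 ∈ enumClasses E x.2 := by
  have h : REPred fun x : (ℕ × ℕ) × ℕ => x.2 ∈ rng x.1.2 ∧ E.r x.2 x.1.1 :=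
    (rePred_mem_rng.comp (g := fun x : (ℕ × ℕ) × ℕ => (x.1.2, x.2))
      ((Computable.snd.comp Computable.fst).pair Computable.snd)).and
    (hE.comp (g := fun x : (ℕ × ℕ) × ℕ => (x.2, x.1.1))
      (Computable.snd.pair (Computable.fst.comp Computable.fst)))
  refine (REPred.exists_nat (p := fun x m => m ∈ rng x.2 ∧ E.r m x.1) h).of_eq fun x => ?_
  rw [enumClasses_eq_image]
  exact exists_congr fun m => and_congr_right fun _ => (Quotient.eq (r := E)).symm

theorem ceClasses_enumClasses (hE : REPred fun x : ℕ × ℕ => E.r x.1 x.2) (e : ℕ) :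
    CEClasses (enumClasses E e) :=
  (rePred_mem_enumClasses hE).comp (Computable.id.pair (Computable.const e))

theorem CEClasses.exists_index {X : Set (Quotient E)} (hX : CEClasses X) :
    ∃ e, enumClasses E e = X := by
  obtain ⟨e, he⟩ := CompFS.exists_index hX
  refine ⟨e, ?_⟩
  rw [enumClasses_eq_image, he]
  exact Set.image_preimage_eq X Quotient.mk_surjective

theorem ceClasses_of_finite (hE : REPred fun x : ℕ × ℕ => E.r x.1 x.2) {X : Set (Quotient E)}
    (hX : X.Finite) : CEClasses X := by
  induction X, hX using Set.Finite.induction_on with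
  | empty => exact REPred.const False
  | @insert c X _ _ ih =>
    induction c using Quotient.inductionOn with
    | h m =>
      have h : REPred fun n : ℕ => E.r n m :=
        hE.comp (g := fun n : ℕ => (n, m)) (Computable.id.pair (Computable.const m))
      refine (h.or ih).of_eq fun n => ?_
      exact or_congr_left (Quotient.eq (r := E)).symm

theorem ceClasses_univ : CEClasses (Set.univ : Set (Quotient E)) :=
  (REPred.const True).of_eq fun _ => by simp

/-- A c.e. property of c.e. sets of classes is monotone: a program enumerates `X` and switches to
`Y` once the property has been confirmed of the program itself. -/
theorem riceShapiro_mono {P : ℕ → Prop} (hP : REPred P)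
    (hext : ∀ e e', enumClasses E e = enumClasses E e' → P e → P e')
    {e e' : ℕ} (hE : REPred fun x : ℕ × ℕ => E.r x.1 x.2)
    (h : enumClasses E e ⊆ enumClasses E e') (he : P e) : P e' := by
  set X := enumClasses E e with hX
  set Y := enumClasses E e' with hY
  obtain ⟨d, hd⟩ := exists_index_self
    (R := fun d n => Quotient.mk E n ∈ X ∨ (Quotient.mk E n ∈ Y ∧ P d))
    (((ceClasses_enumClasses hE e).comp Computable.snd).or
      (((ceClasses_enumClasses hE e').comp Computable.snd).and (hP.comp Computable.fst)))
  have himage : ∀ Z : Set (Quotient E), Quotient.mk E '' {n | Quotient.mk E n ∈ Z} = Z :=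
    fun Z => Set.image_preimage_eq Z Quotient.mk_surjective
  by_cases hPd : P d
  · have h1 : {n | Quotient.mk E n ∈ X ∨ (Quotient.mk E n ∈ Y ∧ P d)} =
        {n | Quotient.mk E n ∈ Y} :=
      Set.ext fun n => ⟨fun hn => hn.elim (fun k => h k) And.left, fun hn => Or.inr ⟨hn, hPd⟩⟩
    refine hext d e' ?_ hPd
    rw [enumClasses_eq_image E d, hd, h1, himage]
  · have h1 : {n | Quotient.mk E n ∈ X ∨ (Quotient.mk E n ∈ Y ∧ P d)} =
        {n | Quotient.mk E n ∈ X} :=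
      Set.ext fun n => ⟨fun hn => hn.elim id fun k => absurd k.2 hPd, fun hn => Or.inl hn⟩
    refine absurd (hext e d ?_ he) hPd
    rw [enumClasses_eq_image E d, hd, h1, himage]

/-- A c.e. property of c.e. sets of classes depends on finitely many classes: a program
enumerates `X` and stops once the property has been confirmed of the program itself. -/
theorem riceShapiro_compact {P : ℕ → Prop} (hP : REPred P)
    (hext : ∀ e e', enumClasses E e = enumClasses E e' → P e → P e')
    {e : ℕ} (hE : REPred fun x : ℕ × ℕ => E.r x.1 x.2) (he : P e) :
    ∃ d, P d ∧ enumClasses E d ⊆ enumClasses E e ∧ (enumClasses E d).Finite := by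
  obtain ⟨q, hq, hqX, hqm⟩ := REPred.exists_stages (ceClasses_enumClasses hE e)
  obtain ⟨p, hp, hpP, hpm⟩ := hP.exists_stages
  -- The bound `n ≤ k` leaves finitely many candidates at each stage `k`.
  have hR : REPred fun x : ℕ × ℕ => ∃ k, x.2 < k ∧ (q x.2 k && !p x.1 k) = true := by
    refine REPred.exists_nat (p := fun (x : ℕ × ℕ) k => x.2 < k ∧ (q x.2 k && !p x.1 k) = true)
      (REPred.and (REPred.nat_lt (Computable.snd.comp Computable.fst) Computable.snd)
        (REPred.of_computable ?_))
    exact Primrec.and.to_comp.comp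
      (hq.comp (Computable.snd.comp Computable.fst) Computable.snd)
      (Primrec.not.to_comp.comp (hp.comp (Computable.fst.comp Computable.fst) Computable.snd))
  obtain ⟨d, hd⟩ := exists_index_self
    (R := fun d n => ∃ k, n < k ∧ (q n k && !p d k) = true) hR
  have hsub : enumClasses E d ⊆ enumClasses E e := by
    rw [enumClasses_eq_image E d, hd]
    rintro _ ⟨n, ⟨k, -, hk⟩, rfl⟩
    exact (hqX n).2 ⟨k, (Bool.and_eq_true _ _ ▸ hk).1⟩
  by_cases hPd : P d
  · refine ⟨d, hPd, hsub, ?_⟩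
    obtain ⟨k₀, hk₀⟩ := (hpP d).1 hPd
    rw [enumClasses_eq_image E d, hd]
    refine ((Set.finite_lt_nat k₀).subset ?_).image _
    rintro n ⟨k, hnk, hk⟩
    refine hnk.trans (lt_of_not_ge fun hle => ?_)
    simp [hpm d k₀ k hle hk₀] at hk
  · refine absurd (hext e d (hsub.antisymm ?_).symm he) hPd
    rw [enumClasses_eq_image E d, hd]
    intro c
    induction c using Quotient.inductionOn with
    | h n =>
      intro hn
      obtain ⟨k, hk⟩ := (hqX n).1 hn
      refine ⟨n, ⟨max k (n + 1), by omega, ?_⟩, rfl⟩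
      have h1 : p d (max k (n + 1)) = false := by
        by_contra hc
        exact hPd ((hpP d).2 ⟨_, by simpa using hc⟩)
      simp [hqm n k _ (le_max_left _ _) hk, h1]

/-- The operator on sets of `E`-classes induced by a map `f` on indices; it is empty off the
c.e. sets of classes. -/
def jumpMap (E : Setoid ℕ) (f : ℕ → ℕ) (X : Set (Quotient E)) : Set (Quotient E) :=
  {c | ∃ e, enumClasses E e = X ∧ c ∈ enumClasses E (f e)}

variable {f : ℕ → ℕ}

theorem jumpMap_enumClasses (hf : IsReduction f (fsJump E) (fsJump E)) (e : ℕ) :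
    jumpMap E f (enumClasses E e) = enumClasses E (f e) := by
  ext c
  constructor
  · rintro ⟨d, hd, hc⟩
    have : enumClasses E (f d) = enumClasses E (f e) := (hf.2 d e).1 hd
    exact this ▸ hc
  · exact fun hc => ⟨e, rfl, hc⟩

theorem ceClasses_jumpMap (hE : REPred fun x : ℕ × ℕ => E.r x.1 x.2)
    (hf : IsReduction f (fsJump E) (fsJump E)) {X : Set (Quotient E)} (hX : CEClasses X) :
    CEClasses (jumpMap E f X) := by
  obtain ⟨e, rfl⟩ := hX.exists_index
  rw [jumpMap_enumClasses hf]
  exact ceClasses_enumClasses hE _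

theorem jumpMap_injective (hf : IsReduction f (fsJump E) (fsJump E)) {X Y : Set (Quotient E)}
    (hX : CEClasses X) (hY : CEClasses Y) (h : jumpMap E f X = jumpMap E f Y) : X = Y := by
  obtain ⟨e, rfl⟩ := hX.exists_index
  obtain ⟨e', rfl⟩ := hY.exists_index
  rw [jumpMap_enumClasses hf, jumpMap_enumClasses hf] at h
  exact (hf.2 e e').2 h

theorem rePred_mem_image_index (hE : REPred fun x : ℕ × ℕ => E.r x.1 x.2) (hf : Computable f)
    (c : Quotient E) : REPred fun e => c ∈ enumClasses E (f e) := by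
  induction c using Quotient.inductionOn with
  | h m =>
    exact (rePred_mem_enumClasses hE).comp (g := fun e => (m, f e))
      ((Computable.const m).pair hf)

theorem jumpMap_mono (hE : REPred fun x : ℕ × ℕ => E.r x.1 x.2)
    (hf : IsReduction f (fsJump E) (fsJump E)) {X Y : Set (Quotient E)}
    (hX : CEClasses X) (hY : CEClasses Y) (h : X ⊆ Y) : jumpMap E f X ⊆ jumpMap E f Y := by
  obtain ⟨e, rfl⟩ := hX.exists_index
  obtain ⟨e', rfl⟩ := hY.exists_index
  rw [jumpMap_enumClasses hf, jumpMap_enumClasses hf]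
  intro c hc
  refine riceShapiro_mono (rePred_mem_image_index hE hf.1 c) ?_ hE h hc
  intro d d' hd hcd
  have : enumClasses E (f d) = enumClasses E (f d') := (hf.2 d d').1 hd
  exact this ▸ hcd

theorem exists_finite_mem_jumpMap (hE : REPred fun x : ℕ × ℕ => E.r x.1 x.2)
    (hf : IsReduction f (fsJump E) (fsJump E)) {X : Set (Quotient E)} (hX : CEClasses X)
    {c : Quotient E} (hc : c ∈ jumpMap E f X) : ∃ D ⊆ X, D.Finite ∧ c ∈ jumpMap E f D := by
  obtain ⟨e, rfl⟩ := hX.exists_index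
  rw [jumpMap_enumClasses hf] at hc
  obtain ⟨d, hd, hsub, hfin⟩ :=
    riceShapiro_compact (rePred_mem_image_index hE hf.1 c) (fun d d' h hcd => by
      have : enumClasses E (f d) = enumClasses E (f d') := (hf.2 d d').1 h
      exact this ▸ hcd) hE hc
  exact ⟨_, hsub, hfin, by rwa [jumpMap_enumClasses hf]⟩

/-- For fixed finite `D`, membership in the image of `D ∪ {[y]}` is c.e. uniformly in `y`. -/
theorem rePred_mem_jumpMap_insert (hE : REPred fun x : ℕ × ℕ => E.r x.1 x.2)
    (hf : IsReduction f (fsJump E) (fsJump E)) {D : Set (Quotient E)} (hD : D.Finite) :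
    REPred fun x : ℕ × ℕ =>
      Quotient.mk E x.1 ∈ jumpMap E f (insert (Quotient.mk E x.2) D) := by
  obtain ⟨i, hi, h⟩ := exists_index_sections (R := fun y n => n = y ∨ Quotient.mk E n ∈ D)
    ((REPred.nat_eq Computable.snd Computable.fst).or
      (REPred.comp (ceClasses_of_finite hE hD) Computable.snd))
  have h' : ∀ y, enumClasses E (i y) = insert (Quotient.mk E y) D := by
    intro y
    rw [enumClasses_eq_image, h]
    ext c
    constructor
    · rintro ⟨n, rfl | hn, rfl⟩
      · exact Set.mem_insert _ _
      · exact Set.mem_insert_of_mem _ hn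
    · rintro (rfl | hc)
      · exact ⟨y, Or.inl rfl, rfl⟩
      · obtain ⟨n, rfl⟩ := Quotient.mk_surjective c
        exact ⟨n, Or.inr hc, rfl⟩
  refine ((rePred_mem_enumClasses hE).comp (g := fun x : ℕ × ℕ => (x.1, f (i x.2)))
    (Computable.fst.pair (hf.1.comp (hi.comp Computable.snd)))).of_eq fun x => ?_
  rw [← h', jumpMap_enumClasses hf]

end Operator

/-! ### Selecting elements of the complement of a maximal set -/

/-- The `k`-th iterate of a partial function at `z`. -/
def iter (g : ℕ →. ℕ) (k z : ℕ) : Part ℕ :=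
  Nat.rec (Part.some z) (fun _ p => p.bind g) k

theorem iter_zero (g : ℕ →. ℕ) (z : ℕ) : iter g 0 z = Part.some z := rfl

theorem iter_succ (g : ℕ →. ℕ) (k z : ℕ) : iter g (k + 1) z = (iter g k z).bind g := rfl

theorem iter_succ' (g : ℕ →. ℕ) (k z : ℕ) :
    iter g (k + 1) z = (g z).bind fun y => iter g k y := by
  induction k with
  | zero => exact (Part.bind_some z g).trans (Part.bind_some_right (g z)).symm
  | succ k ih =>
    rw [iter_succ, ih]
    exact Part.bind_assoc (g z) (fun y => iter g k y) g

theorem rePred_mem_iter {g : ℕ →. ℕ} (hg : Partrec g) :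
    REPred fun x : (ℕ × ℕ) × ℕ => x.2 ∈ iter g x.1.1 x.1.2 := by
  have h : Partrec fun x : ℕ × ℕ => iter g x.1 x.2 :=
    Partrec.nat_rec (f := fun x : ℕ × ℕ => x.1) (g := fun x : ℕ × ℕ => Part.some x.2)
      (h := fun _ y => g y.2) Computable.fst Computable.snd.partrec
      (hg.comp (Computable.snd.comp Computable.snd))
  exact REPred.mem_partrec (g := fun x : ℕ × ℕ => iter g x.1 x.2) h

variable {A : Set ℕ}

theorem IsMaximalSet.eventually_mem (hA : IsMaximalSet A) {W : Set ℕ} (hW : IsCE W)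
    (hinf : (W \ A).Infinite) : ∃ N, ∀ z ≥ N, z ∉ A → z ∈ W := by
  obtain ⟨N, hN⟩ := ((hA.2.2 W hW).resolve_left hinf).bddAbove
  refine ⟨N + 1, fun z hz hzA => ?_⟩
  by_contra hzW
  have : z ≤ N := hN ⟨hzW, hzA⟩
  omega

theorem IsMaximalSet.exists_ge (hA : IsMaximalSet A) (N : ℕ) : ∃ z ≥ N, z ∉ A := by
  obtain ⟨z, hz, hN⟩ := hA.2.1.exists_gt N
  exact ⟨z, hN.le, hz⟩

/-- Disjoint c.e. sets cannot both meet the complement of a maximal set in an infinite set. -/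
theorem IsMaximalSet.not_split (hA : IsMaximalSet A) {V W : Set ℕ} (hV : IsCE V)
    (hdisj : ∀ z ∈ V, z ∉ W) (hVinf : (V \ A).Infinite) (hWinf : (W \ A).Infinite) : False :=
  (hA.2.2 V hV).elim hVinf fun h =>
    hWinf (h.subset fun z hz => ⟨fun hzV => hdisj z hzV hz.1, hz.2⟩)

/-- The even and odd parts of an increasing orbit in the complement would be disjoint infinite
c.e. sets. -/
theorem IsMaximalSet.no_increasing_selector (hA : IsMaximalSet A) {g : ℕ →. ℕ} (hg : Partrec g)
    {N : ℕ} (hdom : ∀ z ≥ N, z ∉ A → ∃ y, y ∈ g z)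
    (hval : ∀ z ≥ N, z ∉ A → ∀ y ∈ g z, z < y ∧ y ∉ A) : False := by
  obtain ⟨b, hbN, hbA⟩ := hA.exists_ge N
  have hex : ∀ k, ∃ y ∈ iter g k b, N ≤ y ∧ y ∉ A := by
    intro k
    induction k with
    | zero => exact ⟨b, Part.mem_some _, hbN, hbA⟩
    | succ k ih =>
      obtain ⟨y, hy, hyN, hyA⟩ := ih
      obtain ⟨x, hx⟩ := hdom y hyN hyA
      obtain ⟨hyx, hxA⟩ := hval y hyN hyA x hx
      exact ⟨x, Part.mem_bind_iff.2 ⟨y, hy, hx⟩, by omega, hxA⟩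
  choose o ho hoN hoA using hex
  have hmono : StrictMono o := by
    refine strictMono_nat_of_lt_succ fun k => ?_
    obtain ⟨y, hy, hx⟩ := Part.mem_bind_iff.1 (ho (k + 1))
    rw [Part.mem_unique hy (ho k)] at hx
    exact (hval _ (hoN k) (hoA k) _ hx).1
  have hce : IsCE {y | ∃ k, y ∈ iter g (2 * k) b} := by
    refine REPred.exists_nat ((rePred_mem_iter hg).comp
      (g := fun x : ℕ × ℕ => ((2 * x.2, b), x.1)) ?_)
    have h2 : Computable fun x : ℕ × ℕ => 2 * x.2 :=
      (Primrec.nat_mul.comp (Primrec.const 2) Primrec.snd).to_comp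
    exact (h2.pair (Computable.const b)).pair Computable.fst
  refine hA.not_split hce (W := Set.range fun k => o (2 * k + 1)) ?_ ?_ ?_
  · rintro z ⟨k, hk⟩ ⟨l, rfl⟩
    have := hmono.injective (Part.mem_unique (ho (2 * k)) hk)
    omega
  · refine (Set.infinite_range_of_injective (f := fun k => o (2 * k)) fun k l h => ?_).mono ?_
    · have := hmono.injective h
      omega
    · rintro _ ⟨k, rfl⟩
      exact ⟨⟨k, ho _⟩, hoA _⟩
  · refine (Set.infinite_range_of_injective (f := fun k => o (2 * k + 1)) fun k l h => ?_).mono ?_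
    · have := hmono.injective h
      omega
    · rintro _ ⟨k, rfl⟩
      exact ⟨⟨k, rfl⟩, hoA _⟩

/-- The parity of the number of steps in which a decreasing selector descends below `N` would
split the complement into two infinite c.e. parts, since the selector swaps the parts and has
finite fibres. -/
theorem IsMaximalSet.no_decreasing_selector (hA : IsMaximalSet A) {g : ℕ →. ℕ} (hg : Partrec g)
    {N : ℕ} (hN : ∀ z, ∀ y ∈ g z, N ≤ z) (hdom : ∀ z ≥ N, z ∉ A → ∃ y, y ∈ g z)
    (hval : ∀ z ≥ N, z ∉ A → ∀ y ∈ g z, y < z ∧ y ∉ A)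
    (hfib : ∀ y, y ∉ A → {z | z ∉ A ∧ y ∈ g z}.Finite) : False := by
  let depth : ℕ → ℕ → Prop := fun z k => ∃ y, y < N ∧ y ∈ iter g k z
  have hzero : ∀ z, depth z 0 → z < N := by
    rintro z ⟨y, hy, hyz⟩
    rw [iter_zero, Part.mem_some_iff] at hyz
    exact hyz ▸ hy
  have hsucc : ∀ z k, depth z (k + 1) → ∃ y ∈ g z, depth y k := by
    rintro z k ⟨x, hx, hxz⟩
    rw [iter_succ'] at hxz
    obtain ⟨y, hy, hxy⟩ := Part.mem_bind_iff.1 hxz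
    exact ⟨y, hy, x, hx, hxy⟩
  have hstep : ∀ z y k, y ∈ g z → depth y k → depth z (k + 1) := by
    rintro z y k hy ⟨x, hx, hxy⟩
    exact ⟨x, hx, by rw [iter_succ']; exact Part.mem_bind_iff.2 ⟨y, hy, hxy⟩⟩
  have huniq : ∀ k z l, depth z k → depth z l → k = l := by
    intro k
    induction k with
    | zero =>
      rintro z (_ | l) hk hl
      · rfl
      · obtain ⟨y, hy, -⟩ := hsucc z l hl
        exact absurd (hN z y hy) (hzero z hk).not_ge
    | succ k ih =>
      rintro z (_ | l) hk hl
      · obtain ⟨y, hy, -⟩ := hsucc z k hk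
        exact absurd (hN z y hy) (hzero z hl).not_ge
      · obtain ⟨y, hy, hk'⟩ := hsucc z k hk
        obtain ⟨y', hy', hl'⟩ := hsucc z l hl
        rw [Part.mem_unique hy' hy] at hl'
        rw [ih y l hk' hl']
  have hex : ∀ z, z ∉ A → ∃ k, depth z k := by
    intro z
    induction z using Nat.strong_induction_on with
    | _ z ih =>
      intro hz
      by_cases hzN : z < N
      · exact ⟨0, z, hzN, Part.mem_some _⟩
      · obtain ⟨y, hy⟩ := hdom z (not_lt.1 hzN) hz
        obtain ⟨hyz, hyA⟩ := hval z (not_lt.1 hzN) hz y hy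
        obtain ⟨k, hk⟩ := ih y hyz hyA
        exact ⟨k + 1, hstep z y k hy hk⟩
  let W : ℕ → Set ℕ := fun i => {z | ∃ k, k % 2 = i ∧ depth z k}
  have hce : ∀ i, IsCE (W i) := by
    intro i
    refine REPred.exists_nat (p := fun z k => k % 2 = i ∧ depth z k)
      (REPred.and (REPred.nat_eq ?_ (Computable.const i)) ?_)
    · exact (Primrec.nat_mod.comp Primrec.snd (Primrec.const 2)).to_comp
    · refine REPred.exists_nat (p := fun (x : ℕ × ℕ) y => y < N ∧ y ∈ iter g x.2 x.1)
        (REPred.and (REPred.nat_lt Computable.snd (Computable.const N))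
          ((rePred_mem_iter hg).comp (g := fun x : (ℕ × ℕ) × ℕ => ((x.1.2, x.1.1), x.2)) ?_))
      exact ((Computable.snd.comp Computable.fst).pair
        (Computable.fst.comp Computable.fst)).pair Computable.snd
  have hinf : ∀ i, i < 2 → (W i \ A).Infinite := by
    intro i hi hfin
    have hall : (Aᶜ : Set ℕ) ⊆
        Set.Iio N ∪ (W i \ A ∪ ⋃ y ∈ W i \ A, {z | z ∉ A ∧ y ∈ g z}) := by
      intro z hz
      by_cases hzN : z < N
      · exact Or.inl hzN
      obtain ⟨k, hk⟩ := hex z hz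
      by_cases hki : k % 2 = i
      · exact Or.inr (Or.inl ⟨⟨k, hki, hk⟩, hz⟩)
      obtain _ | k := k
      · exact absurd (hzero z hk) hzN
      obtain ⟨y, hy, hyk⟩ := hsucc z k hk
      refine Or.inr (Or.inr (Set.mem_biUnion (x := y)
        ⟨⟨k, by omega, hyk⟩, (hval z (not_lt.1 hzN) hz y hy).2⟩ ⟨hz, hy⟩))
    exact hA.2.1 (((Set.finite_Iio N).union
      (hfin.union (hfin.biUnion fun y hy => hfib y hy.2))).subset hall)
  refine hA.not_split (hce 0) (W := W 1) ?_ (hinf 0 (by omega)) (hinf 1 (by omega))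
  rintro z ⟨k, hk, hzk⟩ ⟨l, hl, hzl⟩
  have := huniq k z l hzk hzl
  omega

/-- A c.e. relation that stays in the complement of a maximal set and has finite fibres there is
essentially contained in the identity. -/
theorem IsMaximalSet.finite_ne_of_rePred (hA : IsMaximalSet A) {R : ℕ → ℕ → Prop}
    (hR : REPred fun x : ℕ × ℕ => R x.1 x.2)
    (hval : ∃ N, ∀ z ≥ N, z ∉ A → ∀ y, R z y → y ∉ A)
    (hfib : ∀ y, y ∉ A → {z | z ∉ A ∧ R z y}.Finite) :
    {z | z ∉ A ∧ ∃ y, y ≠ z ∧ R z y}.Finite := by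
  obtain ⟨N, hval⟩ := hval
  have hlt : IsCE {z | ∃ y, y < z ∧ R z y} :=
    REPred.exists_nat (p := fun z y => y < z ∧ R z y)
      (REPred.and (REPred.nat_lt Computable.snd Computable.fst) hR)
  have hgt : IsCE {z | ∃ y, z < y ∧ R z y} :=
    REPred.exists_nat (p := fun z y => z < y ∧ R z y)
      (REPred.and (REPred.nat_lt Computable.fst Computable.snd) hR)
  have hlt' : ({z | ∃ y, y < z ∧ R z y} \ A).Finite := by
    by_contra hinf
    obtain ⟨M, hM⟩ := hA.eventually_mem hlt hinf
    obtain ⟨g, hg, hgR, hgd⟩ := REPred.exists_uniformization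
      (p := fun z y => max M N ≤ z ∧ y < z ∧ R z y) (by
        refine REPred.and ?_ (REPred.and (REPred.nat_lt Computable.snd Computable.fst) hR)
        exact (REPred.nat_lt (Computable.const (max M N))
          (Computable.succ.comp Computable.fst)).of_eq fun x => Nat.lt_succ_iff)
    refine hA.no_decreasing_selector hg (N := max M N) (fun z y hy => (hgR z y hy).1) ?_ ?_ ?_
    · intro z hz hzA
      obtain ⟨y, hy⟩ := hM z (le_of_max_le_left hz) hzA
      exact hgd z ⟨y, hz, hy⟩
    · intro z hz hzA y hy
      obtain ⟨-, h1, h2⟩ := hgR z y hy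
      exact ⟨h1, hval z (le_of_max_le_right hz) hzA y h2⟩
    · exact fun y hy => (hfib y hy).subset fun z hz => ⟨hz.1, (hgR z y hz.2).2.2⟩
  have hgt' : ({z | ∃ y, z < y ∧ R z y} \ A).Finite := by
    by_contra hinf
    obtain ⟨M, hM⟩ := hA.eventually_mem hgt hinf
    obtain ⟨g, hg, hgR, hgd⟩ := REPred.exists_uniformization
      (p := fun z y => z < y ∧ R z y)
      (REPred.and (REPred.nat_lt Computable.fst Computable.snd) hR)
    refine hA.no_increasing_selector hg (N := max M N) ?_ ?_
    · exact fun z hz hzA => hgd z (hM z (le_of_max_le_left hz) hzA)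
    · intro z hz hzA y hy
      obtain ⟨h1, h2⟩ := hgR z y hy
      exact ⟨h1, hval z (le_of_max_le_right hz) hzA y h2⟩
  refine (hlt'.union hgt').subset ?_
  rintro z ⟨hz, y, hyz, hy⟩
  rcases hyz.lt_or_gt with h | h
  · exact Or.inl ⟨⟨y, h, hy⟩, hz⟩
  · exact Or.inr ⟨⟨y, h, hy⟩, hz⟩

/-- The complement of a maximal set is immune. -/
theorem IsMaximalSet.finite_of_disjoint (hA : IsMaximalSet A) {W : Set ℕ} (hW : IsCE W)
    (hdisj : ∀ z ∈ W, z ∉ A) : W.Finite := by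
  by_contra hinf
  have h := hA.finite_ne_of_rePred (R := fun z y => z < y ∧ y ∈ W)
    ((REPred.nat_lt Computable.fst Computable.snd).and (REPred.comp hW Computable.snd))
    ⟨0, fun _ _ _ y hy => hdisj y hy.2⟩
    (fun y _ => (Set.finite_Iio y).subset fun z hz => hz.2.1)
  refine hA.2.1 (h.subset fun z hz => ⟨hz, ?_⟩)
  obtain ⟨y, hy, hzy⟩ := Set.Infinite.exists_gt hinf z
  exact ⟨y, hzy.ne', hzy, hy⟩

theorem IsMaximalSet.nonempty (hA : IsMaximalSet A) : A.Nonempty := by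
  by_contra h
  rw [Set.not_nonempty_iff_eq_empty] at h
  refine Set.infinite_univ (hA.finite_of_disjoint (W := Set.univ) ?_ fun z _ => by simp [h])
  exact (REPred.const True).of_eq fun _ => by simp

/-! ### Injective monotone operators close to the identity -/

/-- A monotone injective operator on finite sets that adds nothing outside a fixed finite set `C`
is induced by a permutation supported on `C`: counting along chains of subsets of `C ∪ Z` shows
that it preserves cardinality. -/
theorem exists_perm_of_subset_union {Q : Type*} {F : Set Q → Set Q} {C : Set Q} (hC : C.Finite)
    (hmono : ∀ X Y : Set Q, X.Finite → Y.Finite → X ⊆ Y → F X ⊆ F Y)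
    (hinj : ∀ X Y : Set Q, X.Finite → Y.Finite → F X = F Y → X = Y)
    (hsub : ∀ Z : Set Q, Z.Finite → F Z ⊆ C ∪ Z) :
    ∃ π : Equiv.Perm Q, (∀ c ∉ C, π c = c) ∧ ∀ Z : Set Q, Z.Finite → F Z = π '' Z := by
  have hfin : ∀ Z : Set Q, Z.Finite → (F Z).Finite := fun Z hZ =>
    (hC.union hZ).subset (hsub Z hZ)
  have hgrow : ∀ Z W : Set Q, Z.Finite → W.Finite → Disjoint W Z →
      (F Z).ncard + W.ncard ≤ (F (W ∪ Z)).ncard := by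
    intro Z W hZ hW
    induction W, hW using Set.Finite.induction_on with
    | empty => simp
    | @insert x W hx hW ih =>
      intro hd
      rw [Set.disjoint_insert_left] at hd
      have hWZ := hW.union hZ
      have hlt : F (W ∪ Z) ⊂ F (insert x (W ∪ Z)) := by
        refine (hmono _ _ hWZ (hWZ.insert x) (Set.subset_insert _ _)).ssubset_of_ne fun h => ?_
        have hmem : x ∈ W ∪ Z := by
          rw [hinj _ _ hWZ (hWZ.insert x) h]
          exact Set.mem_insert _ _
        exact hmem.elim hx hd.1
      have h1 := Set.ncard_lt_ncard hlt (hfin _ (hWZ.insert x))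
      have h2 := ih hd.2
      rw [Set.ncard_insert_of_notMem hx hW, Set.insert_union]
      omega
  have hcard : ∀ Z : Set Q, Z.Finite → (F Z).ncard = Z.ncard := by
    intro Z hZ
    have h1 := hgrow ∅ Z Set.finite_empty hZ (Set.disjoint_empty Z)
    have h2 := hgrow Z (C \ Z) hZ (hC.subset Set.sdiff_subset) Set.disjoint_sdiff_left
    have h3 := Set.ncard_le_ncard (hsub _ (hC.union hZ)) (hC.union (hC.union hZ))
    rw [← Set.union_assoc, Set.union_self] at h3
    have h4 : (C ∪ Z).ncard = (C \ Z).ncard + Z.ncard := by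
      rw [← Set.sdiff_union_self]
      exact Set.ncard_union_eq Set.disjoint_sdiff_left (hC.subset Set.sdiff_subset) hZ
    rw [Set.union_empty] at h1
    rw [Set.sdiff_union_self] at h2
    omega
  have hsingle : ∀ x, ∃ y, F {x} = {y} := fun x =>
    Set.ncard_eq_one.1 ((hcard _ (Set.finite_singleton x)).trans (Set.ncard_singleton x))
  choose π hπ using hsingle
  have hπinj : Function.Injective π := by
    intro x y h
    have := hinj {x} {y} (Set.finite_singleton x) (Set.finite_singleton y) (by rw [hπ, hπ, h])
    exact Set.singleton_injective this
  have himage : ∀ Z : Set Q, Z.Finite → F Z = π '' Z := by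
    intro Z hZ
    symm
    refine Set.eq_of_subset_of_ncard_le ?_ ?_ (hfin Z hZ)
    · rintro _ ⟨x, hx, rfl⟩
      refine hmono {x} Z (Set.finite_singleton x) hZ (Set.singleton_subset_iff.2 hx) ?_
      rw [hπ]
      exact Set.mem_singleton _
    · rw [hcard Z hZ, Set.ncard_image_of_injective Z hπinj]
  have hstable : ∀ Z : Set Q, Z.Finite → C ⊆ Z → π '' Z = Z := by
    intro Z hZ hCZ
    rw [← himage Z hZ]
    refine Set.eq_of_subset_of_ncard_le ?_ (hcard Z hZ).ge hZ
    exact (hsub Z hZ).trans (Set.union_subset hCZ subset_rfl)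
  have hπsurj : Function.Surjective π := by
    intro y
    have h := hstable (insert y C) (hC.insert y) (Set.subset_insert _ _)
    have hy : y ∈ π '' insert y C := by
      rw [h]
      exact Set.mem_insert _ _
    obtain ⟨x, -, hx⟩ := hy
    exact ⟨x, hx⟩
  refine ⟨Equiv.ofBijective π ⟨hπinj, hπsurj⟩, ?_, himage⟩
  intro c hc
  have h : π c ∈ C ∪ {c} := by
    refine hsub {c} (Set.finite_singleton c) ?_
    rw [hπ]
    exact Set.mem_singleton _
  refine h.elim (fun hcC => ?_) id
  rw [← hstable C hC subset_rfl] at hcC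
  obtain ⟨d, hd, hdc⟩ := hcC
  exact absurd (hπinj hdc ▸ hd) hc

/-! ### Reductions of the jump of `E_A` to itself -/

section SetRel

variable {A : Set ℕ}

theorem rePred_setRel (hA : IsCE A) : REPred fun x : ℕ × ℕ => (setRel A).r x.1 x.2 :=
  (REPred.nat_eq Computable.fst Computable.snd).or
    ((REPred.comp hA Computable.fst).and (REPred.comp hA Computable.snd))

theorem mk_eq_mk_iff {m n : ℕ} :
    Quotient.mk (setRel A) m = Quotient.mk (setRel A) n ↔ m = n ∨ (m ∈ A ∧ n ∈ A) :=
  Quotient.eq (r := setRel A)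

theorem mk_eq_mk_of_mem {a n : ℕ} (ha : a ∈ A) :
    Quotient.mk (setRel A) n = Quotient.mk (setRel A) a ↔ n ∈ A := by
  rw [mk_eq_mk_iff]
  exact ⟨fun h => h.elim (fun h => h ▸ ha) And.left, fun h => Or.inr ⟨h, ha⟩⟩

theorem mk_eq_mk_of_notMem {m n : ℕ} (hm : m ∉ A) :
    Quotient.mk (setRel A) n = Quotient.mk (setRel A) m ↔ n = m := by
  rw [mk_eq_mk_iff]
  exact ⟨fun h => h.elim id fun h => absurd h.2 hm, Or.inl⟩

/-- The classes of the elements of the complement are singletons. -/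
theorem mk_injOn_compl : Set.InjOn (Quotient.mk (setRel A)) Aᶜ :=
  fun _ _ _ hn h => (mk_eq_mk_of_notMem hn).1 h

/-- A set of classes is infinite exactly when it contains infinitely many classes of elements of
the complement. -/
theorem infinite_iff_infinite_diff {X : Set (Quotient (setRel A))} :
    X.Infinite ↔ ({n | Quotient.mk (setRel A) n ∈ X} \ A).Infinite := by
  rw [← not_iff_not, Set.not_infinite, Set.not_infinite]
  constructor
  · intro h
    exact Set.Finite.of_injOn (f := Quotient.mk (setRel A)) (fun n hn => hn.1)
      (mk_injOn_compl.mono fun n hn => hn.2) h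
  · intro h
    have hA : (Quotient.mk (setRel A) '' A).Finite := by
      rcases A.eq_empty_or_nonempty with rfl | ⟨a, ha⟩
      · simp
      · refine (Set.finite_singleton (Quotient.mk (setRel A) a)).subset ?_
        rintro _ ⟨n, hn, rfl⟩
        exact (mk_eq_mk_of_mem ha).2 hn
    refine ((h.image (Quotient.mk (setRel A))).union hA).subset fun c hc => ?_
    obtain ⟨n, rfl⟩ := Quotient.mk_surjective c
    by_cases hn : n ∈ A
    · exact Or.inr ⟨n, hn, rfl⟩
    · exact Or.inl ⟨n, ⟨hc, hn⟩, rfl⟩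

theorem IsMaximalSet.infinite_quotient (hA : IsMaximalSet A) : Infinite (Quotient (setRel A)) := by
  rw [← Set.infinite_univ_iff, infinite_iff_infinite_diff]
  exact hA.2.1.mono fun n hn => ⟨trivial, hn⟩

theorem IsMaximalSet.mem_of_infinite (hA : IsMaximalSet A) {X : Set (Quotient (setRel A))}
    (hX : CEClasses X) (hinf : X.Infinite) {a : ℕ} (ha : a ∈ A) :
    Quotient.mk (setRel A) a ∈ X := by
  by_contra haX
  refine infinite_iff_infinite_diff.1 hinf ((hA.finite_of_disjoint hX fun z hz hzA => haX ?_).subset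
    Set.sdiff_subset)
  rw [← (mk_eq_mk_of_mem ha).2 hzA]
  exact hz

theorem IsMaximalSet.finite_compl_of_infinite (hA : IsMaximalSet A)
    {X : Set (Quotient (setRel A))} (hX : CEClasses X) (hinf : X.Infinite) : Xᶜ.Finite := by
  by_contra h
  exact (hA.2.2 _ hX).elim (infinite_iff_infinite_diff.1 hinf) (infinite_iff_infinite_diff.1 h)

theorem ceClasses_compl_singleton {m : ℕ} (hm : m ∉ A) :
    CEClasses ({Quotient.mk (setRel A) m}ᶜ : Set (Quotient (setRel A))) := by
  refine ((REPred.nat_lt Computable.id (Computable.const m)).or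
    (REPred.nat_lt (Computable.const m) Computable.id)).of_eq fun n => ?_
  rw [Set.mem_ofPred_eq, Set.mem_compl_iff, Set.mem_singleton_iff, mk_eq_mk_of_notMem hm]
  exact lt_or_lt_iff_ne

variable {f : ℕ → ℕ}

/-- The image of a finite set of classes is finite: a cofinite image would have only finitely
many sets above it. -/
theorem IsMaximalSet.finite_jumpMap (hA : IsMaximalSet A)
    (hf : IsReduction f (fsJump (setRel A)) (fsJump (setRel A)))
    {D : Set (Quotient (setRel A))} (hD : D.Finite) : (jumpMap (setRel A) f D).Finite := by
  have hE := rePred_setRel hA.1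
  have hce : ∀ {X : Set (Quotient (setRel A))}, X.Finite → CEClasses X := ceClasses_of_finite hE
  have := hA.infinite_quotient
  by_contra hinf
  have hco := hA.finite_compl_of_infinite (ceClasses_jumpMap hE hf (hce hD)) hinf
  have hfin : {Y | jumpMap (setRel A) f D ⊆ Y}.Finite := by
    refine (hco.finite_subsets.image compl).subset fun Y hY => ?_
    exact ⟨Yᶜ, Set.compl_subset_compl.2 hY, compl_compl Y⟩
  refine (Set.Finite.infinite_compl hD) (Set.Finite.of_injOn
    (f := fun c => jumpMap (setRel A) f (insert c D)) (t := {Y | jumpMap (setRel A) f D ⊆ Y})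
    (fun c _ => jumpMap_mono hE hf (hce hD) (hce (hD.insert c)) (Set.subset_insert c D)) ?_ hfin)
  intro c hc d _ h
  have h' := jumpMap_injective hf (hce (hD.insert c)) (hce (hD.insert d)) h
  have hmem : c ∈ insert d D := h' ▸ Set.mem_insert c D
  exact hmem.resolve_right hc

/-- The class `A` belongs to the image of some finite set containing it: the image of the set of
all classes has infinitely many subsets, hence is infinite. -/
theorem IsMaximalSet.exists_finite_mem (hA : IsMaximalSet A)
    (hf : IsReduction f (fsJump (setRel A)) (fsJump (setRel A))) {a : ℕ} (ha : a ∈ A) :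
    ∃ D : Set (Quotient (setRel A)), D.Finite ∧ Quotient.mk _ a ∈ D ∧
      Quotient.mk _ a ∈ jumpMap (setRel A) f D := by
  have hE := rePred_setRel hA.1
  have hce : ∀ {X : Set (Quotient (setRel A))}, X.Finite → CEClasses X := ceClasses_of_finite hE
  have := hA.infinite_quotient
  have hinf : (jumpMap (setRel A) f Set.univ).Infinite := by
    intro hfin
    refine Set.infinite_univ (α := Quotient (setRel A)) (Set.Finite.of_injOn
      (f := fun c => jumpMap (setRel A) f {c}) (fun c _ => jumpMap_mono hE hf
        (hce (Set.finite_singleton c)) ceClasses_univ (Set.subset_univ _)) ?_ hfin.finite_subsets)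
    intro c _ d _ h
    exact Set.singleton_injective
      (jumpMap_injective hf (hce (Set.finite_singleton c)) (hce (Set.finite_singleton d)) h)
  obtain ⟨D, -, hD, haD⟩ := exists_finite_mem_jumpMap hE hf ceClasses_univ
    (hA.mem_of_infinite (ceClasses_jumpMap hE hf ceClasses_univ) hinf ha)
  exact ⟨insert (Quotient.mk _ a) D, hD.insert _, Set.mem_insert _ _,
    jumpMap_mono hE hf (hce hD) (hce (hD.insert _)) (Set.subset_insert _ _) haD⟩

/-- For almost all classes `c`, adding `c` to `D` adds `c` to the image. The relation
`z ∈ F (D ∪ {y})` is c.e. and stays in the complement of `A`, so that it is essentially contained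
in the identity, while infinitely many `z` have some such `y`. -/
theorem IsMaximalSet.finite_notMem_jumpMap_insert (hA : IsMaximalSet A)
    (hf : IsReduction f (fsJump (setRel A)) (fsJump (setRel A))) {a : ℕ} (ha : a ∈ A)
    {D : Set (Quotient (setRel A))} (hD : D.Finite) (haD : Quotient.mk _ a ∈ D)
    (haF : Quotient.mk _ a ∈ jumpMap (setRel A) f D) :
    {c | c ∉ jumpMap (setRel A) f (insert c D)}.Finite := by
  have hE := rePred_setRel hA.1
  have hce : ∀ {X : Set (Quotient (setRel A))}, X.Finite → CEClasses X := ceClasses_of_finite hE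
  have := hA.infinite_quotient
  set F := jumpMap (setRel A) f with hF
  have hR := rePred_mem_jumpMap_insert hE hf hD
  rw [← hF] at hR
  have hFD : (F D).Finite := hA.finite_jumpMap hf hD
  -- A c.e. set of classes without the class `A` is finite.
  have hrow : ∀ c ∉ F D, {d | c ∈ F (insert d D)}.Finite := by
    intro c hc
    obtain ⟨z, rfl⟩ := Quotient.mk_surjective c
    by_contra hinf
    have hrowce : CEClasses {d | Quotient.mk _ z ∈ F (insert d D)} :=
      hR.comp (g := fun y => (z, y)) ((Computable.const z).pair Computable.id)
    have hmem := hA.mem_of_infinite hrowce hinf ha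
    rw [Set.mem_ofPred_eq, Set.insert_eq_of_mem haD] at hmem
    exact hc hmem
  have hnew : ∀ d ∉ D, ∃ c ∈ F (insert d D), c ∉ F D := by
    intro d hd
    by_contra! hno
    have h := jumpMap_injective hf (hce (hD.insert d)) (hce hD)
      (Set.Subset.antisymm hno
        (jumpMap_mono hE hf (hce hD) (hce (hD.insert d)) (Set.subset_insert d D)))
    exact hd (h ▸ Set.mem_insert d D)
  have hall : {c | ∃ d, c ∈ F (insert d D)}.Infinite := by
    intro hfin
    have hfin' : {c | c ∉ F D ∧ ∃ d, c ∈ F (insert d D)}.Finite := hfin.subset fun c hc => hc.2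
    refine Set.Finite.infinite_compl hD
      ((hfin'.biUnion fun c hc => hrow c hc.1).subset fun d hd => ?_)
    obtain ⟨c, hc, hcD⟩ := hnew d hd
    exact Set.mem_biUnion (x := c) ⟨hcD, d, hc⟩ hc
  have hallce : CEClasses {c | ∃ d, c ∈ F (insert d D)} := by
    refine (REPred.exists_nat (p := fun z y => Quotient.mk (setRel A) z ∈
      F (insert (Quotient.mk (setRel A) y) D)) hR).of_eq fun z => ?_
    exact (Quotient.mk_surjective.exists
      (p := fun d => Quotient.mk (setRel A) z ∈ F (insert d D))).symm
  have hmost := hA.finite_compl_of_infinite hallce hall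
  have hoff : {z | z ∉ A ∧ ∃ y, y ≠ z ∧
      Quotient.mk (setRel A) z ∈ F (insert (Quotient.mk (setRel A) y) D)}.Finite := by
    refine hA.finite_ne_of_rePred hR ?_ ?_
    · have hb : ({n | Quotient.mk (setRel A) n ∈ F D} \ A).Finite := by
        by_contra h
        exact infinite_iff_infinite_diff.2 h hFD
      obtain ⟨N, hN⟩ := hb.bddAbove
      refine ⟨N + 1, fun z hz hzA y hy hyA => ?_⟩
      rw [(mk_eq_mk_of_mem ha).2 hyA, Set.insert_eq_of_mem haD] at hy
      have : z ≤ N := hN ⟨hy, hzA⟩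
      omega
    · intro y _
      by_contra h
      refine infinite_iff_infinite_diff.2
        (Set.Infinite.mono (fun z hz => ⟨hz.2, hz.1⟩) h)
        (hA.finite_jumpMap hf (hD.insert (Quotient.mk (setRel A) y)))
  refine (hmost.union (hoff.image (Quotient.mk (setRel A)))).subset fun c hc => ?_
  obtain ⟨z, rfl⟩ := Quotient.mk_surjective c
  by_cases h : ∃ d, Quotient.mk (setRel A) z ∈ F (insert d D)
  · obtain ⟨d, hd⟩ := h
    obtain ⟨y, rfl⟩ := Quotient.mk_surjective d
    refine Or.inr ⟨z, ⟨fun hzA => hc ?_, y, ?_, hd⟩, rfl⟩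
    · rw [(mk_eq_mk_of_mem ha).2 hzA, Set.insert_eq_of_mem haD]
      exact haF
    · rintro rfl
      exact hc hd
  · exact Or.inl h

/-- Outside a finite set, the induced operator adds no classes. If the complement of `{c}` had `c`
in its image, that image would omit only classes from a fixed finite set, and by injectivity this
happens for finitely many `c`. -/
theorem IsMaximalSet.exists_jumpMap_subset_union (hA : IsMaximalSet A)
    (hf : IsReduction f (fsJump (setRel A)) (fsJump (setRel A))) :
    ∃ C : Set (Quotient (setRel A)), C.Finite ∧
      ∀ X, CEClasses X → jumpMap (setRel A) f X ⊆ C ∪ X := by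
  have hE := rePred_setRel hA.1
  have hce : ∀ {X : Set (Quotient (setRel A))}, X.Finite → CEClasses X := ceClasses_of_finite hE
  obtain ⟨a, ha⟩ := hA.nonempty
  obtain ⟨D, hD, haD, haF⟩ := hA.exists_finite_mem hf ha
  have hC₀ := (hA.finite_notMem_jumpMap_insert hf ha hD haD haF).union hD
  set F := jumpMap (setRel A) f with hF
  set C₀ := {c | c ∉ F (insert c D)} ∪ D with hC₀def
  have hcompl : ∀ c ∉ C₀, CEClasses ({c}ᶜ : Set (Quotient (setRel A))) := by
    intro c hc
    obtain ⟨z, rfl⟩ := Quotient.mk_surjective c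
    refine ceClasses_compl_singleton fun hz => hc (Or.inr ?_)
    rwa [(mk_eq_mk_of_mem ha).2 hz]
  have hbad : {c | c ∉ C₀ ∧ c ∈ F {c}ᶜ}.Finite := by
    refine Set.Finite.of_injOn (f := fun c => (F {c}ᶜ)ᶜ) (t := {T | T ⊆ C₀}) ?_ ?_
      hC₀.finite_subsets
    · rintro c ⟨hc, hcF⟩ d hd
      by_contra hdC
      have hdc : d ≠ c := by
        rintro rfl
        exact hd hcF
      have hdF : d ∈ F (insert d D) := by
        by_contra h
        exact hdC (Or.inl h)
      refine hd (jumpMap_mono hE hf (hce (hD.insert d)) (hcompl c hc) ?_ hdF)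
      rintro x (rfl | hx) rfl
      · exact hdc rfl
      · exact hc (Or.inr hx)
    · intro c hc d hd h
      have := jumpMap_injective hf (hcompl c hc.1) (hcompl d hd.1) (compl_injective h)
      exact Set.singleton_injective (compl_injective this)
  refine ⟨C₀ ∪ {c | c ∉ C₀ ∧ c ∈ F {c}ᶜ}, hC₀.union hbad, fun X hX c hc => ?_⟩
  by_cases hcC : c ∈ C₀
  · exact Or.inl (Or.inl hcC)
  by_cases hcX : c ∈ X
  · exact Or.inr hcX
  refine Or.inl (Or.inr ⟨hcC, jumpMap_mono hE hf hX (hcompl c hcC) ?_ hc⟩)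
  rintro x hx rfl
  exact hcX hx

/-- A reduction of the jump of `E_A` to itself acts as a finite-support permutation of the classes,
which fixes the class `A` since the complement of `A` is not c.e. -/
theorem IsMaximalSet.exists_perm (hA : IsMaximalSet A)
    (hf : IsReduction f (fsJump (setRel A)) (fsJump (setRel A))) :
    ∃ π : Equiv.Perm (Quotient (setRel A)), {c | π c ≠ c}.Finite ∧
      (∀ a ∈ A, π (Quotient.mk _ a) = Quotient.mk _ a) ∧
      ∀ e, enumClasses (setRel A) (f e) = π '' enumClasses (setRel A) e := by
  have hE := rePred_setRel hA.1
  have hce : ∀ {X : Set (Quotient (setRel A))}, X.Finite → CEClasses X := ceClasses_of_finite hE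
  obtain ⟨C, hC, hsub⟩ := hA.exists_jumpMap_subset_union hf
  obtain ⟨π, hfix, himage⟩ := exists_perm_of_subset_union (F := jumpMap (setRel A) f) hC
    (fun X Y hX hY => jumpMap_mono hE hf (hce hX) (hce hY))
    (fun X Y hX hY => jumpMap_injective hf (hce hX) (hce hY))
    (fun Z hZ => hsub Z (hce hZ))
  have himage' : ∀ X, CEClasses X → jumpMap (setRel A) f X = π '' X := by
    intro X hX
    ext c
    constructor
    · intro hc
      obtain ⟨D, hDX, hD, hcD⟩ := exists_finite_mem_jumpMap hE hf hX hc
      rw [himage D hD] at hcD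
      exact Set.image_mono hDX hcD
    · rintro ⟨d, hd, rfl⟩
      refine jumpMap_mono hE hf (hce (Set.finite_singleton d)) hX (Set.singleton_subset_iff.2 hd) ?_
      rw [himage _ (Set.finite_singleton d)]
      exact ⟨d, rfl, rfl⟩
  refine ⟨π, hC.subset fun c hc => ?_, fun a ha => ?_, fun e => ?_⟩
  · by_contra h
    exact hc (hfix c h)
  · obtain ⟨s, hs⟩ := Quotient.mk_surjective (π.symm (Quotient.mk _ a))
    have hs' : π (Quotient.mk _ s) = Quotient.mk _ a := by rw [hs, Equiv.apply_symm_apply]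
    by_cases hsA : s ∈ A
    · rwa [(mk_eq_mk_of_mem ha).2 hsA] at hs'
    -- Otherwise the complement of the class `A` would be the image of a c.e. set of classes.
    exfalso
    have hX := ceClasses_compl_singleton hsA
    have hFX := ceClasses_jumpMap hE hf hX
    rw [himage' _ hX, Set.image_compl_eq π.bijective, Set.image_singleton, hs'] at hFX
    have := hA.infinite_quotient
    exact hA.mem_of_infinite hFX (Set.finite_singleton _).infinite_compl ha rfl
  · rw [← jumpMap_enumClasses hf, himage' _ (ceClasses_enumClasses hE e)]

/-- A permutation of the classes with finite support that fixes the class `A` preserves c.e. sets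
of classes under preimage, as it differs from the identity at finitely many numbers outside `A`. -/
theorem CEClasses.preimage_perm {π : Equiv.Perm (Quotient (setRel A))} (hπ : {c | π c ≠ c}.Finite)
    (hfix : ∀ a ∈ A, π (Quotient.mk _ a) = Quotient.mk _ a) {X : Set (Quotient (setRel A))}
    (hX : CEClasses X) : CEClasses (π ⁻¹' X) := by
  have hS : {n | π (Quotient.mk _ n) ≠ Quotient.mk (setRel A) n}.Finite := by
    refine Set.Finite.of_injOn (f := Quotient.mk (setRel A)) (t := {c | π c ≠ c})
      (fun n hn => hn) (mk_injOn_compl.mono fun n hn hnA => hn (hfix n hnA)) hπ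
  set S := {n | π (Quotient.mk _ n) ≠ Quotient.mk (setRel A) n} with hSdef
  have hfin : ∀ T : Set ℕ, T.Finite → IsCE T := by
    intro T hT
    induction T, hT using Set.Finite.induction_on with
    | empty => exact REPred.const False
    | @insert m T _ _ ih =>
      exact (REPred.nat_eq Computable.id (Computable.const m)).or ih
  have hcofin : ∀ T : Set ℕ, T.Finite → IsCE Tᶜ := by
    intro T hT
    induction T, hT using Set.Finite.induction_on with
    | empty => exact (REPred.const True).of_eq fun _ => by simp
    | @insert m T _ _ ih =>
      refine (((REPred.nat_lt Computable.id (Computable.const m)).or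
        (REPred.nat_lt (Computable.const m) Computable.id)).and ih).of_eq fun n => ?_
      rw [Set.mem_compl_iff, Set.mem_compl_iff, Set.mem_insert_iff, not_or]
      exact and_congr_left fun _ => lt_or_lt_iff_ne
  refine ((REPred.and hX (hcofin S hS)).or
    (hfin {n | n ∈ S ∧ π (Quotient.mk _ n) ∈ X} (hS.subset fun n hn => hn.1))).of_eq fun n => ?_
  by_cases hn : n ∈ S
  · simp [hn]
  · have : π (Quotient.mk _ n) = Quotient.mk (setRel A) n := not_not.1 hn
    simp [hn, this]

end SetRel

end CompFS

theorem mainTheorem4 (A : Set ℕ) (hA : CompFS.IsMaximalSet A) :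
    CompFS.SelfFull (CompFS.fsJump (CompFS.setRel A)) ∧
    ∀ f : ℕ → ℕ,
      CompFS.IsReduction f (CompFS.fsJump (CompFS.setRel A)) (CompFS.fsJump (CompFS.setRel A)) →
      ∃ π : Equiv.Perm (Quotient (CompFS.setRel A)),
        {c | π c ≠ c}.Finite ∧
        ∀ e : ℕ, CompFS.enumClasses (CompFS.setRel A) (f e) =
          π '' CompFS.enumClasses (CompFS.setRel A) e := by
  refine ⟨fun f hf y => ?_, fun f hf => ?_⟩
  · obtain ⟨π, hπ, hfix, himage⟩ := hA.exists_perm hf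
    obtain ⟨x, hx⟩ := ((CompFS.ceClasses_enumClasses (CompFS.rePred_setRel hA.1) y).preimage_perm
      hπ hfix).exists_index
    refine ⟨x, ?_⟩
    change CompFS.enumClasses _ (f x) = CompFS.enumClasses _ y
    rw [himage, hx, Set.image_preimage_eq _ π.surjective]
  · obtain ⟨π, hπ, -, himage⟩ := hA.exists_perm hf
    exact ⟨π, hπ, himage⟩
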